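/- Let $F$ be a probability distribution on $[0,\infty)$ which either has a density with respect to Lebesgue measure or is a lattice distribution, i.e. is concentrated on a set $b+a\mathbb{Z}$ with $b\in\mathbb{R}$, $a>0$. For a jointly measurable real-valued process $(Y_t)_{t\in\mathbb{R}}$ on a probability space write $\overline{Y}_F:=\int_{[0,\infty)}Y_t\,dF(t)$. Then the identity $$\mathbb{E}\bigl(Y_0 \mid \overline{Y}_F\bigr)=\overline{Y}_F\quad\text{almost surely}$$ holds for every jointly measurable (strictly) stationary process $(Y_t)_{t\in\mathbb{R}}$ with $\mathbb{E}|Y_0|<\infty$ if and only if either $F$ has density $\lambda e^{-\lambda t}$, $t\ge 0$, for some $\lambda\in(0,\infty)$, or $F=\delta_0$. -/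

import Mathlib

open MeasureTheory ProbabilityTheory

/-- A real process `Y` indexed by `ℝ` is (strictly) stationary under `P`: for every shift `h`, all
finite-dimensional distributions of `(Y (t + h))` and `(Y t)` agree. -/
def IsStationaryProcess {Ω : Type*} [MeasurableSpace Ω] (Y : ℝ → Ω → ℝ) (P : Measure Ω) : Prop :=
  ∀ (h : ℝ) (n : ℕ) (t : Fin n → ℝ),
    P.map (fun ω i => Y (t i + h) ω) = P.map (fun ω i => Y (t i) ω)

/-- `F` has a density with respect to Lebesgue measure. -/
def HasLebesgueDensity (F : Measure ℝ) : Prop :=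
  ∃ f : ℝ → ENNReal, Measurable f ∧ F = volume.withDensity f

/-- `F` is a lattice distribution: it is concentrated on `b + aℤ` for some `b` and some `a > 0`. -/
def IsLatticeDistribution (F : Measure ℝ) : Prop :=
  ∃ b a : ℝ, 0 < a ∧ ∀ᵐ x ∂F, ∃ k : ℤ, x = b + k * a

/-- The weighted average `∫ Y_t dF(t)` of a process; it is used for `F` concentrated
on `[0, ∞)`, with a possible atom of `F` at `0` included. -/
noncomputable def weightedAverage {Ω : Type*} (F : Measure ℝ) (Y : ℝ → Ω → ℝ) (ω : Ω) : ℝ :=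
  ∫ t in Set.Ici 0, Y t ω ∂F

/-- The identity `E(Y_0 | Ȳ) = Ȳ` a.s., with `Ȳ` the weighted average of `Y` with respect to `F`;
the conditioning is on the `σ`-field generated by the real random variable `Ȳ`. -/
def ConditioningIdentity {Ω : Type*} [MeasurableSpace Ω] (F : Measure ℝ) (Y : ℝ → Ω → ℝ)
    (P : Measure Ω) : Prop :=
  P[Y 0 | MeasurableSpace.comap (weightedAverage F Y) inferInstance] =ᵐ[P] weightedAverage F Y

/-- For a jointly measurable process the conditioning `σ`-field is a sub-`σ`-field of the ambient
one, so that the conditional expectation above is the genuine one. -/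
theorem comap_weightedAverage_le {Ω : Type*} [m : MeasurableSpace Ω] (F : Measure ℝ)
    [IsProbabilityMeasure F] (Y : ℝ → Ω → ℝ) (hY : Measurable (Function.uncurry Y)) :
    MeasurableSpace.comap (weightedAverage F Y) inferInstance ≤ m := by
  have h : StronglyMeasurable (fun ω => ∫ t, Y t ω ∂(F.restrict (Set.Ici 0))) :=
    StronglyMeasurable.integral_prod_right (f := fun ω t => Y t ω)
      (hY.comp measurable_swap).stronglyMeasurable
  exact h.measurable.comap_le

-- Necessity. Let `φ = charFun F`. On the 2-torus with Haar measure, a linear flow with frequencies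
-- `s, t` and a trigonometric polynomial in the characters `u`, `v`, `(uv)⁻¹` give a bounded
-- stationary process. Averaging over `F` only multiplies the three coefficients by `φ s`, `φ t`, `φ
-- (-(s + t))`. The product of the characters is 1, so the third-moment consequence `E (Y 0 - Z) Z²
-- = 0` of the identity leaves a cubic relation for `φ`
-- (`charFun_relation_of_conditioningIdentity`). Divided by the product of the three values, it says
-- that `1 / φ - 1` is additive; hence `φ s = 1 / (1 - i c s)`, and the support condition forces `c
-- ≥ 0` (`eq_expMeasure_or_dirac_of_relation`).
--
-- Sufficiency. For exponential `F`, the shifted average `Z s = ∫ Y (t + s) dF(t)` solves `Z' = r (Z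
-- - Y)` along almost every path. If `Φ' = g` with `g` continuous of compact support, then `Φ (Z 1)
-- - Φ (Z 0)` is the integral over `[0, 1]` of `r g(Z s) (Z s - Y s)`. The pair `(Z s, Y s)` has a
-- law independent of `s` (`IsStationaryProcess.map_integral_prodMk_eq`), so expectations give `E
-- g(Z) (Z - Y 0) = 0`, and such `g` determine the conditional expectation. For `δ₀` the average is
-- `Y 0` itself.

universe u

/-! ### The exponential law: integrals and characteristic function. -/

theorem expMeasure_eq_withDensity_restrict (r : ℝ) :
    expMeasure r = (volume.restrict (Set.Ioi 0)).withDensity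
      (fun x => ENNReal.ofReal (r * Real.exp (-(r * x)))) := by
  have h : expMeasure r = volume.withDensity (exponentialPDF r) := rfl
  rw [h, ← withDensity_indicator measurableSet_Ioi]
  refine withDensity_congr_ae ?_
  have h0 : ∀ᵐ x : ℝ, x ≠ 0 := by simp [ae_iff, measure_singleton]
  filter_upwards [h0] with x hx
  rcases lt_or_gt_of_ne hx with hx | hx
  · rw [exponentialPDF_of_neg hx, Set.indicator_of_notMem (by simpa using hx.le)]
  · rw [exponentialPDF_of_nonneg hx.le, Set.indicator_of_mem (by simpa using hx)]

theorem integral_expMeasure {E : Type*} [NormedAddCommGroup E] [NormedSpace ℝ E] {r : ℝ}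
    (hr : 0 < r) (f : ℝ → E) :
    ∫ x, f x ∂(expMeasure r) = ∫ x in Set.Ioi 0, (r * Real.exp (-(r * x))) • f x := by
  rw [expMeasure_eq_withDensity_restrict,
    integral_withDensity_eq_integral_toReal_smul (by fun_prop) (by simp)]
  refine integral_congr_ae (Filter.Eventually.of_forall fun x => ?_)
  simp only
  rw [ENNReal.toReal_ofReal (by positivity)]

theorem integrable_expMeasure_iff {E : Type*} [NormedAddCommGroup E] [NormedSpace ℝ E] {r : ℝ}
    (hr : 0 < r) (f : ℝ → E) :
    Integrable f (expMeasure r) ↔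
      IntegrableOn (fun x => (r * Real.exp (-(r * x))) • f x) (Set.Ioi 0) := by
  rw [expMeasure_eq_withDensity_restrict,
    integrable_withDensity_iff_integrable_smul' (by fun_prop) (by simp), IntegrableOn]
  refine integrable_congr (Filter.Eventually.of_forall fun x => ?_)
  simp only
  rw [ENNReal.toReal_ofReal (by positivity)]

theorem expMeasure_Iic_zero (r : ℝ) : expMeasure r (Set.Iic 0) = 0 := by
  rw [expMeasure_eq_withDensity_restrict]
  refine withDensity_absolutelyContinuous _ _ ?_
  rw [Measure.restrict_apply measurableSet_Iic]
  have : Set.Iic (0 : ℝ) ∩ Set.Ioi 0 = ∅ := by ext; simp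
  simp [this]

theorem charFun_expMeasure {r : ℝ} (hr : 0 < r) (ξ : ℝ) :
    charFun (expMeasure r) ξ = (1 - (r⁻¹ * ξ : ℝ) * Complex.I)⁻¹ := by
  have hr' : (r : ℂ) ≠ 0 := by exact_mod_cast hr.ne'
  set a : ℂ := -r + ξ * Complex.I with ha
  have hare : a.re < 0 := by simp [ha, hr]
  have ha0 : a ≠ 0 := by
    intro h
    simp [h] at hare
  rw [charFun_apply_real, integral_expMeasure hr]
  have h1 : ∀ x : ℝ, (r * Real.exp (-(r * x))) • Complex.exp (ξ * x * Complex.I)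
      = r * Complex.exp (a * x) := by
    intro x
    rw [Complex.real_smul]
    push_cast
    rw [mul_assoc, ← Complex.exp_add]
    congr 2
    rw [ha]
    ring
  simp_rw [h1]
  rw [integral_const_mul, integral_exp_mul_complex_Ioi hare]
  have h2 : 1 - ((r⁻¹ * ξ : ℝ) : ℂ) * Complex.I = - a / r := by
    rw [ha]
    push_cast
    field_simp
    ring
  rw [h2]
  simp [div_eq_mul_inv]

/-! ### Solving the cubic relation for the characteristic function. -/

/-- With both arguments equal to `x / 2`, a zero at `x` kills every term except the square of the
value at `x / 2`. Zeros therefore propagate to `x / 2ⁿ`, contradicting continuity and the value 1 at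
the origin. -/
theorem charFun_ne_zero_of_relation (F : Measure ℝ) [IsProbabilityMeasure F]
    (h : ∀ s t, charFun F s * charFun F t + charFun F s * charFun F (-(s + t))
      + charFun F t * charFun F (-(s + t)) = 3 * (charFun F s * charFun F t * charFun F (-(s + t))))
    (s : ℝ) : charFun F s ≠ 0 := by
  intro hs
  have hhalf : ∀ x, charFun F x = 0 → charFun F (x / 2) = 0 := by
    intro x hx
    have h1 := h (x / 2) (x / 2)
    rw [add_halves, charFun_neg, hx] at h1
    simpa using h1
  have hn : ∀ n : ℕ, charFun F (s * (1 / 2) ^ n) = 0 := by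
    intro n
    induction n with
    | zero => simpa using hs
    | succ n ih =>
      have := hhalf _ ih
      rwa [show s * (1 / 2) ^ n / 2 = s * (1 / 2) ^ (n + 1) by ring] at this
  have hlim : Filter.Tendsto (fun n : ℕ => charFun F (s * (1 / 2) ^ n)) Filter.atTop
      (nhds (charFun F 0)) := by
    refine ((continuous_charFun (μ := F)).tendsto 0).comp ?_
    have := (tendsto_pow_atTop_nhds_zero_of_lt_one (r := (1 / 2 : ℝ)) (by norm_num)
      (by norm_num)).const_mul s
    simpa using this
  simp_rw [hn] at hlim
  have := tendsto_nhds_unique hlim tendsto_const_nhds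
  simp at this

theorem exists_charFun_eq_of_relation (F : Measure ℝ) [IsProbabilityMeasure F]
    (h : ∀ s t, charFun F s * charFun F t + charFun F s * charFun F (-(s + t))
      + charFun F t * charFun F (-(s + t)) =
        3 * (charFun F s * charFun F t * charFun F (-(s + t)))) :
    ∃ c : ℝ, ∀ s : ℝ, charFun F s = (1 - (c * s : ℝ) * Complex.I)⁻¹ := by
  have hne := charFun_ne_zero_of_relation F h
  have h0 : charFun F 0 = 1 := by simp
  have hsum : ∀ s t, (charFun F s)⁻¹ + (charFun F t)⁻¹ + (charFun F (-(s + t)))⁻¹ = 3 := by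
    intro s t
    have h1 := hne s
    have h2 := hne t
    have h3 := hne (-(s + t))
    field_simp
    linear_combination h s t
  have hneg : ∀ s, (charFun F (-s))⁻¹ = 2 - (charFun F s)⁻¹ := by
    intro s
    have := hsum s 0
    rw [h0, add_zero] at this
    linear_combination this
  let ψ : ℝ →+ ℂ :=
    { toFun := fun s => (charFun F s)⁻¹ - 1
      map_zero' := by simp
      map_add' := fun s t => by
        have h1 := hsum s t
        rw [hneg] at h1
        linear_combination -h1 }
  have hψ : Continuous ψ := (continuous_charFun.inv₀ hne).sub continuous_const
  have hlin : ∀ s : ℝ, (charFun F s)⁻¹ - 1 = s * ((charFun F 1)⁻¹ - 1) := by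
    intro s
    have := (ψ.toRealLinearMap hψ).map_smul s (1 : ℝ)
    simpa [ψ] using this
  -- Reflection is complex conjugation for a characteristic function and negation for the additive
  -- map, so the slope is purely imaginary.
  have hre : ((charFun F 1)⁻¹ - 1).re = 0 := by
    have h1 := hneg 1
    rw [charFun_neg, ← map_inv₀] at h1
    have h2 := congrArg Complex.re h1
    simp only [Complex.conj_re, Complex.sub_re, Complex.re_ofNat] at h2
    simp only [Complex.sub_re, Complex.one_re]
    linarith
  refine ⟨-((charFun F 1)⁻¹ - 1).im, fun s => ?_⟩
  rw [← inv_inv (charFun F s)]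
  congr 1
  have h1 : (charFun F 1)⁻¹ - 1 = (((charFun F 1)⁻¹ - 1).im : ℝ) * Complex.I := by
    apply Complex.ext <;> simp [hre]
  have h2 := hlin s
  rw [h1] at h2
  push_cast
  linear_combination h2

/-- The cubic relation says that `1 / φ - 1` is additive for the characteristic function `φ`; by
continuity `1 / φ - 1` is linear, which singles out the exponential laws and `δ₀`. -/
theorem eq_expMeasure_or_dirac_of_relation (F : Measure ℝ) [IsProbabilityMeasure F]
    (hF : F (Set.Iio 0) = 0)
    (h : ∀ s t, charFun F s * charFun F t + charFun F s * charFun F (-(s + t))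
      + charFun F t * charFun F (-(s + t)) =
        3 * (charFun F s * charFun F t * charFun F (-(s + t)))) :
    (∃ r : ℝ, 0 < r ∧ F = expMeasure r) ∨ F = Measure.dirac 0 := by
  obtain ⟨c, hc⟩ := exists_charFun_eq_of_relation F h
  rcases lt_trichotomy c 0 with hc0 | hc0 | hc0
  -- For `c < 0` the law would be that of a negated exponential variable, which lives on the
  -- negative half-line.
  · exfalso
    have hr : 0 < (-c)⁻¹ := by simpa using hc0
    have := isProbabilityMeasure_expMeasure hr
    have hmap : F = (expMeasure (-c)⁻¹).map (fun x => (-1) * x) := by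
      have : IsProbabilityMeasure ((expMeasure (-c)⁻¹).map (fun x => (-1) * x)) :=
        Measure.isProbabilityMeasure_map (by fun_prop)
      refine Measure.ext_of_charFun (funext fun s => ?_)
      rw [charFun_map_mul, charFun_expMeasure hr, hc]
      simp
    rw [hmap, Measure.map_apply (by fun_prop) measurableSet_Iio] at hF
    have h1 : (fun x : ℝ => (-1) * x) ⁻¹' Set.Iio 0 = (Set.Iic 0)ᶜ := by ext; simp
    rw [h1, prob_compl_eq_zero_iff measurableSet_Iic, expMeasure_Iic_zero] at hF
    exact zero_ne_one hF
  · right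
    refine Measure.ext_of_charFun (funext fun s => ?_)
    rw [hc, hc0, charFun_dirac]
    simp
  · left
    have hr : 0 < c⁻¹ := by simpa using hc0
    have := isProbabilityMeasure_expMeasure hr
    refine ⟨c⁻¹, hr, Measure.ext_of_charFun (funext fun s => ?_)⟩
    rw [charFun_expMeasure hr, hc, inv_inv]

/-! ### The conditioning identity as a third-moment condition. -/

theorem ConditioningIdentity.integral_sub_mul_sq_eq_zero {Ω : Type*} [MeasurableSpace Ω]
    {F : Measure ℝ} [IsProbabilityMeasure F] {P : Measure Ω} [IsProbabilityMeasure P]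
    {Y : ℝ → Ω → ℝ} (h : ConditioningIdentity F Y P) (hY : Measurable (Function.uncurry Y))
    (hint : Integrable (Y 0) P) {C : ℝ} (hC : ∀ ω, |weightedAverage F Y ω| ≤ C) :
    ∫ ω, (Y 0 ω - weightedAverage F Y ω) * weightedAverage F Y ω ^ 2 ∂P = 0 := by
  set Z := weightedAverage F Y with hZ
  have hm := comap_weightedAverage_le F Y hY
  rw [← hZ] at hm
  have hZm : Measurable[MeasurableSpace.comap Z inferInstance] Z := comap_measurable Z
  have hZ2 : StronglyMeasurable[MeasurableSpace.comap Z inferInstance] (fun ω => Z ω ^ 2) :=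
    (hZm.pow_const 2).stronglyMeasurable
  have hZint : Integrable Z P :=
    Integrable.of_bound (hZm.mono hm le_rfl).aestronglyMeasurable C
      (Filter.Eventually.of_forall fun ω => by simpa using hC ω)
  have hbd : ∀ ω, ‖Z ω ^ 2‖ ≤ C ^ 2 := fun ω => by
    rw [norm_pow]
    exact pow_le_pow_left₀ (norm_nonneg _) (hC ω) 2
  have hsq : AEStronglyMeasurable (fun ω => Z ω ^ 2) P := (hZ2.mono hm).aestronglyMeasurable
  have h1 : Integrable ((fun ω => Z ω ^ 2) * Y 0) P :=
    hint.bdd_mul hsq (Filter.Eventually.of_forall hbd)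
  have h2 : Integrable ((fun ω => Z ω ^ 2) * Z) P :=
    hZint.bdd_mul hsq (Filter.Eventually.of_forall hbd)
  have h3 := condExp_mul_of_stronglyMeasurable_left hZ2 h1 hint
  have h4 : ∫ ω, ((fun ω => Z ω ^ 2) * Y 0) ω ∂P = ∫ ω, ((fun ω => Z ω ^ 2) * Z) ω ∂P := by
    rw [← integral_condExp hm]
    refine integral_congr_ae ?_
    have h5 : P[Y 0 | MeasurableSpace.comap Z inferInstance] =ᵐ[P] Z := h
    filter_upwards [h3, h5] with ω h6 h7
    rw [h6, Pi.mul_apply, Pi.mul_apply, h7]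
  have h8 : (fun ω => (Y 0 ω - Z ω) * Z ω ^ 2)
      = fun ω => ((fun ω => Z ω ^ 2) * Y 0) ω - ((fun ω => Z ω ^ 2) * Z) ω := by
    funext ω
    simp only [Pi.mul_apply]
    ring
  rw [h8, integral_sub h1 h2, h4, sub_self]

/-! ### Third moments on the torus. -/

noncomputable instance Circle.instMeasurableSpaceBorel : MeasurableSpace Circle := borel Circle

instance Circle.instBorelSpaceBorel : BorelSpace Circle := ⟨rfl⟩

/-- The normalised Haar measure on the two-dimensional torus. -/
noncomputable def torusHaar : Measure (Circle × Circle) :=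
  Measure.haarMeasure (⊤ : TopologicalSpace.PositiveCompacts (Circle × Circle))

instance : IsProbabilityMeasure torusHaar := ⟨Measure.haarMeasure_self⟩

instance : Measure.IsMulLeftInvariant torusHaar :=
  inferInstanceAs (Measure.IsMulLeftInvariant (Measure.haarMeasure _))

theorem integrable_torusHaar {f : Circle × Circle → ℝ} (hf : Continuous f) :
    Integrable f torusHaar := by
  obtain ⟨C, hC⟩ := isCompact_univ.exists_bound_of_continuousOn hf.continuousOn
  exact Integrable.of_bound hf.aestronglyMeasurable C
    (Filter.Eventually.of_forall fun x => hC x (Set.mem_univ x))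

theorem integral_torusHaar_eq_average {f : Circle × Circle → ℝ} (hf : Continuous f)
    (g₁ g₂ g₃ : Circle × Circle) :
    ∫ g, f g ∂torusHaar
      = (∫ g, (f g + f (g₁ * g) + f (g₂ * g) + f (g₃ * g)) ∂torusHaar) / 4 := by
  have h : ∀ a : Circle × Circle, Integrable (fun g => f (a * g)) torusHaar := fun a =>
    integrable_torusHaar (hf.comp (continuous_const.mul continuous_id))
  have h0 := integrable_torusHaar hf
  rw [integral_add ((h0.fun_add (h g₁)).fun_add (h g₂)) (h g₃),
    integral_add (h0.fun_add (h g₁)) (h g₂),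
    integral_add h0 (h g₁), integral_mul_left_eq_self, integral_mul_left_eq_self,
    integral_mul_left_eq_self]
  ring

/-- The imaginary unit as an element of the circle. -/
noncomputable def Circle.imagUnit : Circle := ⟨Complex.I, by simp [Submonoid.unitSphere]⟩

@[simp]
theorem Circle.coe_imagUnit : (Circle.imagUnit : ℂ) = Complex.I := rfl

/-- The real part of the trigonometric polynomial `a u + b v + c (uv)⁻¹` on the torus. -/
noncomputable def torusForm (a b c : ℂ) (g : Circle × Circle) : ℝ :=
  (a * g.1).re + (b * g.2).re + (c * (g.1⁻¹ * g.2⁻¹ : Circle)).re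

theorem continuous_torusForm (a b c : ℂ) : Continuous (torusForm a b c) := by
  unfold torusForm
  fun_prop

/-- Summing over the translates by `1` or `i` in each coordinate cancels all oscillating terms
pointwise: what remains is the real part of the product of the three complex factors, in which the
characters multiply to 1. -/
theorem integral_torusHaar_re_mul_re_mul_re (a b c : ℂ) :
    ∫ g, (a * g.1).re * (b * g.2).re * (c * (g.1⁻¹ * g.2⁻¹ : Circle)).re ∂torusHaar
      = (a * b * c).re / 4 := by
  rw [integral_torusHaar_eq_average (by fun_prop) (Circle.imagUnit, 1) (1, Circle.imagUnit)
    (Circle.imagUnit, Circle.imagUnit)]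
  congr 1
  have hconst : (a * b * c).re = ∫ _, (a * b * c).re ∂torusHaar := by simp
  rw [hconst]
  refine integral_congr_ae (Filter.Eventually.of_forall fun g => ?_)
  simp only
  have h : a * b * c = (a * g.1) * (b * g.2) * (c * (g.1⁻¹ * g.2⁻¹ : Circle)) := by
    have h1 := Circle.coe_ne_zero g.1
    have h2 := Circle.coe_ne_zero g.2
    push_cast
    field_simp
  rw [h]
  set p := a * (g.1 : ℂ) with hp
  set q := b * (g.2 : ℂ) with hq
  set w := c * ((g.1⁻¹ * g.2⁻¹ : Circle) : ℂ) with hw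
  have e1 : a * ((Circle.imagUnit * g.1 : Circle) : ℂ) = Complex.I * p := by
    rw [hp]; push_cast; rw [Circle.coe_imagUnit]; ring
  have e2 : b * ((Circle.imagUnit * g.2 : Circle) : ℂ) = Complex.I * q := by
    rw [hq]; push_cast; rw [Circle.coe_imagUnit]; ring
  have e3 : c * (((Circle.imagUnit * g.1)⁻¹ * g.2⁻¹ : Circle) : ℂ) = -Complex.I * w := by
    rw [hw]; push_cast; rw [Circle.coe_imagUnit, mul_inv, Complex.inv_I]; ring
  have e4 : c * ((g.1⁻¹ * (Circle.imagUnit * g.2)⁻¹ : Circle) : ℂ) = -Complex.I * w := by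
    rw [hw]; push_cast; rw [Circle.coe_imagUnit, mul_inv, Complex.inv_I]; ring
  have e5 : c * (((Circle.imagUnit * g.1)⁻¹ * (Circle.imagUnit * g.2)⁻¹ : Circle) : ℂ) = -w := by
    rw [hw]; push_cast; rw [Circle.coe_imagUnit, mul_inv, mul_inv, Complex.inv_I]
    linear_combination (c * (g.1 : ℂ)⁻¹ * (g.2 : ℂ)⁻¹) * Complex.I_mul_I
  simp only [Prod.fst_mul, Prod.snd_mul, one_mul, e1, e2, e3, e4, e5, ← hp, ← hq]
  simp only [Complex.mul_re, Complex.mul_im, Complex.neg_re, Complex.neg_im, Complex.I_re,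
    Complex.I_im]
  ring

theorem integral_torusHaar_torusForm_sub_mul_sq (a b c p q r : ℂ) :
    ∫ g, (torusForm a b c g - torusForm p q r g) * torusForm p q r g ^ 2 ∂torusHaar
      = ((a * q * r + p * b * r + p * q * c - 3 * (p * q * r)).re) / 2 := by
  let T (x y z : ℂ) (g : Circle × Circle) : ℝ :=
    (x * g.1).re * (y * g.2).re * (z * (g.1⁻¹ * g.2⁻¹ : Circle)).re
  have hT : ∀ x y z, Integrable (T x y z) torusHaar := fun x y z =>
    integrable_torusHaar (by fun_prop)
  have hf := continuous_torusForm
  -- Averaging over sign changes keeps only the cubic monomials that contain each of the three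
  -- characters once.
  rw [integral_torusHaar_eq_average (by fun_prop) (-1, 1) (1, -1) (-1, -1)]
  have key : ∀ g : Circle × Circle,
      (torusForm a b c g - torusForm p q r g) * torusForm p q r g ^ 2
      + (torusForm a b c ((-1, 1) * g) - torusForm p q r ((-1, 1) * g))
          * torusForm p q r ((-1, 1) * g) ^ 2
      + (torusForm a b c ((1, -1) * g) - torusForm p q r ((1, -1) * g))
          * torusForm p q r ((1, -1) * g) ^ 2
      + (torusForm a b c ((-1, -1) * g) - torusForm p q r ((-1, -1) * g))
          * torusForm p q r ((-1, -1) * g) ^ 2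
      = 8 * (T a q r g + T p b r g + T p q c g - 3 * T p q r g) := by
    intro g
    have e1 : ∀ x y z, torusForm x y z ((-1, 1) * g)
        = - (x * g.1).re + (y * g.2).re - (z * (g.1⁻¹ * g.2⁻¹ : Circle)).re := by
      intro x y z
      simp [torusForm, inv_neg]
      ring
    have e2 : ∀ x y z, torusForm x y z ((1, -1) * g)
        = (x * g.1).re - (y * g.2).re - (z * (g.1⁻¹ * g.2⁻¹ : Circle)).re := by
      intro x y z
      simp [torusForm, inv_neg]
      ring
    have e3 : ∀ x y z, torusForm x y z ((-1, -1) * g)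
        = - (x * g.1).re - (y * g.2).re + (z * (g.1⁻¹ * g.2⁻¹ : Circle)).re := by
      intro x y z
      simp [torusForm, inv_neg]
      ring
    simp only [e1, e2, e3]
    simp only [torusForm, T]
    ring
  simp_rw [key]
  rw [integral_const_mul, integral_sub (((hT _ _ _).fun_add (hT _ _ _)).fun_add (hT _ _ _))
    ((hT _ _ _).const_mul 3), integral_add ((hT _ _ _).fun_add (hT _ _ _)) (hT _ _ _),
    integral_add (hT _ _ _) (hT _ _ _), integral_const_mul]
  simp only [T, integral_torusHaar_re_mul_re_mul_re]
  have h3 : (3 * (p * q * r)).re = 3 * (p * q * r).re := by simp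
  rw [Complex.sub_re, Complex.add_re, Complex.add_re, h3]
  ring

/-! ### Stationary processes from flows, and the cubic relation. -/

theorem IsStationaryProcess.of_measurePreserving {Ω : Type*} [MeasurableSpace Ω]
    {P : Measure Ω} {Y : ℝ → Ω → ℝ} (hY : ∀ t, Measurable (Y t)) (τ : ℝ → Ω → Ω)
    (hτ : ∀ h, MeasurePreserving (τ h) P P) (hYτ : ∀ h t ω, Y (t + h) ω = Y t (τ h ω)) :
    IsStationaryProcess Y P := by
  intro h n t
  have h1 : (fun ω (i : Fin n) => Y (t i + h) ω) = (fun ω i => Y (t i) ω) ∘ τ h := by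
    funext ω i
    exact hYτ h (t i) ω
  rw [h1, ← Measure.map_map (measurable_pi_lambda _ fun i => hY (t i)) (hτ h).measurable,
    (hτ h).map_eq]

/-- The point `(e^{isτ}, e^{itτ})` at time `τ` of the linear flow on the torus with frequencies `s, t`. -/
noncomputable def torusFlow (s t τ : ℝ) : Circle × Circle :=
  (Circle.exp (s * τ), Circle.exp (t * τ))

theorem torusFlow_add (s t τ h : ℝ) :
    torusFlow s t (τ + h) = torusFlow s t τ * torusFlow s t h := by
  simp [torusFlow, mul_add, Circle.exp_add]

theorem torusFlow_zero (s t : ℝ) : torusFlow s t 0 = 1 := by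
  simp [torusFlow]

theorem continuous_torusFlow (s t : ℝ) : Continuous (torusFlow s t) := by
  unfold torusFlow
  fun_prop

theorem integrable_torusFlow_character (F : Measure ℝ) [IsProbabilityMeasure F] (s : ℝ) (z : ℂ) :
    Integrable (fun τ : ℝ => z * Complex.exp (s * τ * Complex.I)) F := by
  refine Integrable.of_bound (C := ‖z‖) (by fun_prop) (Filter.Eventually.of_forall fun τ => ?_)
  rw [norm_mul, ← Complex.ofReal_mul, Complex.norm_exp_ofReal_mul_I, mul_one]

theorem integral_re_mul_exp (F : Measure ℝ) [IsProbabilityMeasure F] (s : ℝ) (z : ℂ) :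
    ∫ τ : ℝ, (z * Complex.exp (s * τ * Complex.I)).re ∂F = (z * charFun F s).re := by
  have h := integral_re (integrable_torusFlow_character F s z)
  rw [integral_const_mul, ← charFun_apply_real] at h
  exact h

theorem torusForm_torusFlow_mul (a b c : ℂ) (s t τ : ℝ) (g : Circle × Circle) :
    torusForm a b c (torusFlow s t τ * g) =
      (a * g.1 * Complex.exp (s * τ * Complex.I)).re + (b * g.2 * Complex.exp (t * τ * Complex.I)).re
      + (c * (g.1⁻¹ * g.2⁻¹ : Circle) * Complex.exp ((-(s + t) : ℝ) * τ * Complex.I)).re := by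
  have h : Complex.exp ((-(s + t) : ℝ) * τ * Complex.I)
      = (Complex.exp (s * τ * Complex.I))⁻¹ * (Complex.exp (t * τ * Complex.I))⁻¹ := by
    rw [← Complex.exp_neg, ← Complex.exp_neg, ← Complex.exp_add]
    congr 1
    push_cast
    ring
  rw [h]
  simp only [torusForm, torusFlow, Prod.fst_mul, Prod.snd_mul]
  push_cast
  refine congrArg₂ _ (congrArg₂ _ (congrArg _ ?_) (congrArg _ ?_)) (congrArg _ ?_)
  · ring
  · ring
  · rw [mul_inv, mul_inv]; ring

theorem integral_torusForm_torusFlow_mul (F : Measure ℝ) [IsProbabilityMeasure F] (a b c : ℂ)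
    (s t : ℝ) (g : Circle × Circle) :
    ∫ τ, torusForm a b c (torusFlow s t τ * g) ∂F =
      torusForm (a * charFun F s) (b * charFun F t) (c * charFun F (-(s + t))) g := by
  have hi := fun s z => (integrable_torusFlow_character F s z).re
  simp only [RCLike.re_to_complex] at hi
  simp_rw [torusForm_torusFlow_mul]
  rw [integral_add ((hi _ _).fun_add (hi _ _)) (hi _ _), integral_add (hi _ _) (hi _ _),
    integral_re_mul_exp, integral_re_mul_exp, integral_re_mul_exp, torusForm]
  refine congrArg₂ _ (congrArg₂ _ (congrArg _ ?_) (congrArg _ ?_)) (congrArg _ ?_) <;> ring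

theorem measurable_torusForm_torusFlow_mul (a b c : ℂ) (s t : ℝ) :
    Measurable fun p : ℝ × (Circle × Circle) => torusForm a b c (torusFlow s t p.1 * p.2) := by
  have h : Continuous fun p : ℝ × (Circle × Circle) =>
      torusForm a b c (torusFlow s t p.1 * p.2) :=
    (continuous_torusForm a b c).comp
      (((continuous_torusFlow s t).comp continuous_fst).mul continuous_snd)
  exact h.measurable

theorem integral_sub_mul_sq_eq_zero_of_flow {F : Measure ℝ} [IsProbabilityMeasure F]
    (hF : F (Set.Iio 0) = 0)
    (h : ∀ (Ω : Type u) [MeasurableSpace Ω] (P : Measure Ω) [IsProbabilityMeasure P]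
        (Y : ℝ → Ω → ℝ),
        Measurable (Function.uncurry Y) → IsStationaryProcess Y P → Integrable (Y 0) P →
        ConditioningIdentity F Y P)
    {G : Type} [MeasurableSpace G] [Group G] [MeasurableMul G] {μ : Measure G}
    [IsProbabilityMeasure μ] [μ.IsMulLeftInvariant] {γ : ℝ → G} (hγ0 : γ 0 = 1)
    (hγ : ∀ s t, γ (s + t) = γ s * γ t) {f f' : G → ℝ} {C : ℝ} (hfC : ∀ g, |f g| ≤ C)
    (hf : Measurable fun p : ℝ × G => f (γ p.1 * p.2))
    (hf' : ∀ g, ∫ τ, f (γ τ * g) ∂F = f' g) :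
    ∫ g, (f g - f' g) * f' g ^ 2 ∂μ = 0 := by
  -- The hypothesis speaks of probability spaces in `Type u`, while `G` lives in `Type`; the process
  -- is carried over to a lifted copy.
  obtain ⟨Ω, _, ⟨e⟩⟩ : ∃ (Ω : Type u) (_ : MeasurableSpace Ω), Nonempty (Ω ≃ᵐ G) :=
    ⟨ULift.{u} G, inferInstance, ⟨MeasurableEquiv.ulift⟩⟩
  let P : Measure Ω := μ.map e.symm
  have hP : IsProbabilityMeasure P := Measure.isProbabilityMeasure_map e.symm.measurable.aemeasurable
  have hmp : MeasurePreserving e.symm μ P := ⟨e.symm.measurable, rfl⟩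
  have hmp' : MeasurePreserving e P μ := hmp.symm e.symm
  let Y : ℝ → Ω → ℝ := fun τ ω => f (γ τ * e ω)
  have hYm : Measurable (Function.uncurry Y) :=
    hf.comp (measurable_fst.prodMk (e.measurable.comp measurable_snd))
  have hYt : ∀ τ, Measurable (Y τ) := fun τ => hYm.comp measurable_prodMk_left
  have hY0 : ∀ ω, Y 0 ω = f (e ω) := fun ω => by simp [Y, hγ0]
  have hstat : IsStationaryProcess Y P := by
    refine IsStationaryProcess.of_measurePreserving hYt
      (fun h ω => e.symm (γ h * e ω)) (fun h => ?_) (fun h τ ω => ?_)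
    · exact hmp.comp ((measurePreserving_mul_left μ _).comp hmp')
    · simp only [Y, hγ, MeasurableEquiv.apply_symm_apply, mul_assoc]
  have hint : Integrable (Y 0) P :=
    Integrable.of_bound (hYt 0).aestronglyMeasurable C
      (Filter.Eventually.of_forall fun ω => hfC _)
  have hwa : ∀ ω, weightedAverage F Y ω = f' (e ω) := by
    intro ω
    have hr : F.restrict (Set.Ici 0) = F := by
      refine Measure.restrict_eq_self_of_ae_mem ?_
      rw [ae_iff]
      convert hF using 2
      ext; simp
    rw [weightedAverage, hr, ← hf']
  have hwaC : ∀ ω, |weightedAverage F Y ω| ≤ C := by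
    intro ω
    rw [hwa, ← hf']
    have := norm_integral_le_of_norm_le_const (μ := F) (f := fun τ => f (γ τ * e ω)) (C := C)
      (Filter.Eventually.of_forall fun τ => hfC _)
    simpa using this
  have key := (h _ P Y hYm hstat hint).integral_sub_mul_sq_eq_zero hYm hint hwaC
  simp_rw [hwa, hY0] at key
  rwa [hmp'.integral_comp e.measurableEmbedding (fun g => (f g - f' g) * f' g ^ 2)] at key

/-- A real process yields only a real part; the free coefficient `c` rotates the complex expression,
so that its imaginary part can be recovered too. -/
theorem re_charFun_relation_of_conditioningIdentity (F : Measure ℝ) [IsProbabilityMeasure F]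
    (hF : F (Set.Iio 0) = 0)
    (h : ∀ (Ω : Type u) [MeasurableSpace Ω] (P : Measure Ω) [IsProbabilityMeasure P]
        (Y : ℝ → Ω → ℝ),
        Measurable (Function.uncurry Y) → IsStationaryProcess Y P → Integrable (Y 0) P →
        ConditioningIdentity F Y P) (s t : ℝ) (c : ℂ) :
    (c * (charFun F s * charFun F t + charFun F s * charFun F (-(s + t))
      + charFun F t * charFun F (-(s + t))
      - 3 * (charFun F s * charFun F t * charFun F (-(s + t))))).re = 0 := by
  obtain ⟨C, hC⟩ := isCompact_univ.exists_bound_of_continuousOn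
    (continuous_torusForm 1 1 c).continuousOn
  have key := integral_sub_mul_sq_eq_zero_of_flow hF h (μ := torusHaar)
    (torusFlow_zero s t) (torusFlow_add s t) (fun g => hC g (Set.mem_univ g))
    (measurable_torusForm_torusFlow_mul 1 1 c s t)
    (integral_torusForm_torusFlow_mul F 1 1 c s t)
  rw [integral_torusHaar_torusForm_sub_mul_sq] at key
  have h2 : c * (charFun F s * charFun F t + charFun F s * charFun F (-(s + t))
      + charFun F t * charFun F (-(s + t))
      - 3 * (charFun F s * charFun F t * charFun F (-(s + t)))) =
      1 * (1 * charFun F t) * (c * charFun F (-(s + t)))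
      + 1 * charFun F s * 1 * (c * charFun F (-(s + t)))
      + 1 * charFun F s * (1 * charFun F t) * c
      - 3 * (1 * charFun F s * (1 * charFun F t) * (c * charFun F (-(s + t)))) := by ring
  rw [h2]
  linarith

/-- The conditioning identity for the three-frequency process
`Re (e^{isτ} u + e^{itτ} v + c e^{-i(s+t)τ} (uv)⁻¹)` on the torus, tested against the squared average, yields a cubic relation for `charFun F`. -/
theorem charFun_relation_of_conditioningIdentity (F : Measure ℝ) [IsProbabilityMeasure F]
    (hF : F (Set.Iio 0) = 0)
    (h : ∀ (Ω : Type u) [MeasurableSpace Ω] (P : Measure Ω) [IsProbabilityMeasure P]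
        (Y : ℝ → Ω → ℝ),
        Measurable (Function.uncurry Y) → IsStationaryProcess Y P → Integrable (Y 0) P →
        ConditioningIdentity F Y P) (s t : ℝ) :
    charFun F s * charFun F t + charFun F s * charFun F (-(s + t))
      + charFun F t * charFun F (-(s + t))
      = 3 * (charFun F s * charFun F t * charFun F (-(s + t))) := by
  have h1 := re_charFun_relation_of_conditioningIdentity F hF h s t 1
  have h2 := re_charFun_relation_of_conditioningIdentity F hF h s t (-Complex.I)
  rw [one_mul] at h1
  rw [neg_mul, Complex.neg_re, Complex.I_mul_re, neg_neg] at h2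
  exact sub_eq_zero.mp (Complex.ext h1 h2)

/-! ### Joint stationarity of a process and its shifted average. -/

theorem IsStationaryProcess.identDistrib {Ω : Type*} [MeasurableSpace Ω] {P : Measure Ω}
    {Y : ℝ → Ω → ℝ} (hst : IsStationaryProcess Y P) (hY : ∀ t, Measurable (Y t)) (s : ℝ) :
    IdentDistrib (Y s) (Y 0) P P where
  aemeasurable_fst := (hY s).aemeasurable
  aemeasurable_snd := (hY 0).aemeasurable
  map_eq := by
    have h := congrArg (fun μ => μ.map (fun x : Fin 1 → ℝ => x 0)) (hst s 1 (fun _ => 0))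
    rw [Measure.map_map (by fun_prop) (measurable_pi_lambda _ fun i => hY _),
      Measure.map_map (by fun_prop) (measurable_pi_lambda _ fun i => hY _)] at h
    simpa [Function.comp_def] using h

theorem IsStationaryProcess.integrable_prod {Ω : Type*} [MeasurableSpace Ω] {P : Measure Ω}
    [IsProbabilityMeasure P] {Y : ℝ → Ω → ℝ} (hst : IsStationaryProcess Y P)
    (hY : Measurable (Function.uncurry Y)) (hint : Integrable (Y 0) P)
    (F : Measure ℝ) [IsFiniteMeasure F] (s : ℝ) :
    Integrable (fun p : ℝ × Ω => Y (p.1 + s) p.2) (F.prod P) := by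
  have hYt : ∀ t, Measurable (Y t) := fun t => hY.comp measurable_prodMk_left
  have hm : Measurable fun p : ℝ × Ω => Y (p.1 + s) p.2 :=
    hY.comp ((measurable_fst.add_const s).prodMk measurable_snd)
  rw [integrable_prod_iff hm.aestronglyMeasurable]
  refine ⟨Filter.Eventually.of_forall fun t =>
    ((hst.identDistrib hYt (t + s)).integrable_iff).mpr hint, ?_⟩
  have h : ∀ t, ∫ ω, ‖Y (t + s) ω‖ ∂P = ∫ ω, ‖Y 0 ω‖ ∂P := fun t =>
    ((hst.identDistrib hYt (t + s)).comp measurable_norm).integral_eq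
  simp_rw [h]
  exact integrable_const _

/-- Strong law of large numbers for an integrand evaluated at independent sample points. -/
theorem ae_tendsto_sampleMean_integral (F : Measure ℝ) [IsProbabilityMeasure F] {f : ℝ → ℝ}
    (hf : Measurable f) (hint : Integrable f F) :
    ∀ᵐ u ∂(Measure.infinitePi fun _ : ℕ => F), Filter.Tendsto
      (fun n : ℕ => (∑ i ∈ Finset.range n, f (u i)) / n) Filter.atTop (nhds (∫ t, f t ∂F)) := by
  have hmap : ∀ i, (Measure.infinitePi fun _ : ℕ => F).map (fun u => f (u i)) = F.map f := by
    intro i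
    have h := Measure.map_map (μ := Measure.infinitePi fun _ : ℕ => F) hf
      (measurable_pi_apply i)
    rw [show (fun u : ℕ → ℝ => f (u i)) = f ∘ (fun u => u i) from rfl, ← h]
    congr 1
    exact Measure.infinitePi_map_eval (fun _ : ℕ => F) i
  have hm : ∀ i : ℕ, Measurable fun u : ℕ → ℝ => f (u i) := fun i =>
    hf.comp (measurable_pi_apply i)
  have h0 : IdentDistrib (fun u : ℕ → ℝ => f (u 0)) f (Measure.infinitePi fun _ : ℕ => F) F :=
    ⟨(hm 0).aemeasurable, hf.aemeasurable, hmap 0⟩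
  have := strong_law_ae_real (μ := Measure.infinitePi fun _ : ℕ => F)
    (fun (i : ℕ) (u : ℕ → ℝ) => f (u i)) (h0.integrable_iff.mpr hint)
    (fun i j hij => (iIndepFun_infinitePi (P := fun _ : ℕ => F) (X := fun _ => f)
      (fun _ => hf)).indepFun hij)
    (fun i => ⟨(hm i).aemeasurable, (hm 0).aemeasurable, by rw [hmap i, hmap 0]⟩)
  rwa [h0.integral_eq] at this

theorem IsStationaryProcess.integral_sampleMean_eq {Ω : Type*} [MeasurableSpace Ω] {P : Measure Ω}
    {Y : ℝ → Ω → ℝ} (hst : IsStationaryProcess Y P) (hY : ∀ t, Measurable (Y t))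
    {ψ : ℝ × ℝ → ℝ} (hψ : Measurable ψ) (u : ℕ → ℝ) (n : ℕ) (s : ℝ) :
    ∫ ω, ψ ((∑ i ∈ Finset.range n, Y (u i + s) ω) / n, Y s ω) ∂P
      = ∫ ω, ψ ((∑ i ∈ Finset.range n, Y (u i) ω) / n, Y 0 ω) ∂P := by
  -- Time `0` is prepended to the sample times so that one finite-dimensional law carries both the
  -- mean and `Y 0`.
  let t : Fin (n + 1) → ℝ := Fin.cons 0 fun i => u i
  let Φ : (Fin (n + 1) → ℝ) → ℝ := fun x => ψ ((∑ i : Fin n, x i.succ) / n, x 0)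
  have hΦ : Measurable Φ := hψ.comp (by fun_prop)
  have h : ∀ s, ∫ ω, ψ ((∑ i ∈ Finset.range n, Y (u i + s) ω) / n, Y (0 + s) ω) ∂P
      = ∫ x, Φ x ∂(P.map fun ω i => Y (t i + s) ω) := by
    intro s
    rw [integral_map (measurable_pi_lambda _ fun i => hY _).aemeasurable
      hΦ.aestronglyMeasurable]
    simp only [Φ, t, Fin.cons_succ, Fin.cons_zero,
      ← Fin.sum_univ_eq_sum_range (fun i => Y (u i + s) _)]
  have h1 := h s
  have h2 := h 0
  rw [hst s] at h1
  simp only [add_zero, zero_add] at h1 h2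
  rw [h1, h2]

/-- The joint law of the shifted average and the process is shift invariant, although stationarity
only concerns finite-dimensional distributions: the average is a limit of means over i.i.d.
sample times. -/
theorem IsStationaryProcess.map_integral_prodMk_eq {Ω : Type*} [MeasurableSpace Ω] {P : Measure Ω}
    [IsProbabilityMeasure P] {Y : ℝ → Ω → ℝ} (hst : IsStationaryProcess Y P)
    (hY : Measurable (Function.uncurry Y)) (hint : Integrable (Y 0) P)
    (F : Measure ℝ) [IsProbabilityMeasure F] (s : ℝ) :
    P.map (fun ω => (∫ t, Y (t + s) ω ∂F, Y s ω)) = P.map (fun ω => (∫ t, Y t ω ∂F, Y 0 ω)) := by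
  have hYt : ∀ t, Measurable (Y t) := fun t => hY.comp measurable_prodMk_left
  have hYω : ∀ s ω, Measurable fun t => Y (t + s) ω := fun s ω =>
    hY.comp ((measurable_id.add_const s).prodMk measurable_const)
  have hW : ∀ s, Measurable fun ω => ∫ t, Y (t + s) ω ∂F := fun s =>
    (StronglyMeasurable.integral_prod_right (f := fun ω t => Y (t + s) ω)
      (hY.comp ((measurable_snd.add_const s).prodMk measurable_fst)).stronglyMeasurable).measurable
  have hpair : ∀ s, Measurable fun ω => (∫ t, Y (t + s) ω ∂F, Y s ω) := fun s =>
    (hW s).prodMk (hYt s)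
  have hlim : ∀ (ψ : BoundedContinuousFunction (ℝ × ℝ) ℝ) (s : ℝ), Filter.Tendsto
      (fun n : ℕ => ∫ u, ∫ ω, ψ ((∑ i ∈ Finset.range n, Y (u i + s) ω) / n, Y s ω) ∂P
        ∂(Measure.infinitePi fun _ : ℕ => F)) Filter.atTop
      (nhds (∫ ω, ψ (∫ t, Y (t + s) ω ∂F, Y s ω) ∂P)) := by
    intro ψ s
    have hterm : ∀ i : ℕ, Measurable fun p : (ℕ → ℝ) × Ω => Y (p.1 i + s) p.2 := by
      intro i
      have hg : Measurable fun p : (ℕ → ℝ) × Ω => (p.1 i + s, p.2) := by fun_prop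
      exact hY.comp hg
    have hjm : ∀ n : ℕ, Measurable fun p : (ℕ → ℝ) × Ω =>
        ψ ((∑ i ∈ Finset.range n, Y (p.1 i + s) p.2) / n, Y s p.2) := by
      intro n
      have hsum : Measurable fun p : (ℕ → ℝ) × Ω => ∑ i ∈ Finset.range n, Y (p.1 i + s) p.2 :=
        Finset.measurable_sum _ fun i _ => hterm i
      exact ψ.continuous.measurable.comp
        ((hsum.div_const _).prodMk ((hYt s).comp measurable_snd))
    -- Stationarity needs fixed sample times `u`, whereas the law of large numbers needs a fixed
    -- path `ω`; Fubini passes between the two.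
    have hswap : ∀ n : ℕ, ∫ u, ∫ ω, ψ ((∑ i ∈ Finset.range n, Y (u i + s) ω) / n, Y s ω) ∂P
        ∂(Measure.infinitePi fun _ : ℕ => F) =
        ∫ ω, ∫ u, ψ ((∑ i ∈ Finset.range n, Y (u i + s) ω) / n, Y s ω)
          ∂(Measure.infinitePi fun _ : ℕ => F) ∂P := fun n =>
      integral_integral_swap (Integrable.of_bound (hjm n).aestronglyMeasurable ‖ψ‖
        (Filter.Eventually.of_forall fun p => ψ.norm_coe_le_norm _))
    simp_rw [hswap]
    refine tendsto_integral_of_dominated_convergence (fun _ => ‖ψ‖) (fun n => ?_)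
      (integrable_const _) (fun n => Filter.Eventually.of_forall fun ω => ?_) ?_
    · exact ((hjm n).comp measurable_swap).stronglyMeasurable.integral_prod_right'
        |>.aestronglyMeasurable
    · have := norm_integral_le_of_norm_le_const (μ := Measure.infinitePi fun _ : ℕ => F)
        (f := fun u => ψ ((∑ i ∈ Finset.range n, Y (u i + s) ω) / n, Y s ω)) (C := ‖ψ‖)
        (Filter.Eventually.of_forall fun u => ψ.norm_coe_le_norm _)
      simpa using this
    · filter_upwards [(hst.integrable_prod hY hint F s).prod_left_ae] with ω hω
      have hconst : ψ (∫ t, Y (t + s) ω ∂F, Y s ω)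
          = ∫ _, ψ (∫ t, Y (t + s) ω ∂F, Y s ω) ∂(Measure.infinitePi fun _ : ℕ => F) := by simp
      rw [hconst]
      refine tendsto_integral_of_dominated_convergence (fun _ => ‖ψ‖)
        (fun n => ((hjm n).comp measurable_prodMk_right).aestronglyMeasurable)
        (integrable_const _) (fun n => Filter.Eventually.of_forall fun u =>
          ψ.norm_coe_le_norm _) ?_
      filter_upwards [ae_tendsto_sampleMean_integral F (hYω s ω) hω] with u hu
      exact (ψ.continuous.tendsto _).comp (hu.prodMk_nhds tendsto_const_nhds)
  have h0 : (fun ω => (∫ t, Y t ω ∂F, Y 0 ω)) = fun ω => (∫ t, Y (t + 0) ω ∂F, Y 0 ω) := by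
    simp
  rw [h0]
  have := Measure.isProbabilityMeasure_map (μ := P) (hpair s).aemeasurable
  have := Measure.isProbabilityMeasure_map (μ := P) (hpair 0).aemeasurable
  refine ext_of_forall_integral_eq_of_IsFiniteMeasure fun ψ => ?_
  rw [integral_map (hpair s).aemeasurable ψ.continuous.aestronglyMeasurable,
    integral_map (hpair 0).aemeasurable ψ.continuous.aestronglyMeasurable]
  refine tendsto_nhds_unique (hlim ψ s) ?_
  have h2 := hlim ψ 0
  simp_rw [add_zero] at h2 ⊢
  simp_rw [hst.integral_sampleMean_eq hYt ψ.continuous.measurable _ _ s]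
  exact h2

/-! ### Sufficiency: the exponential law and the point mass. -/

/-- The conditional expectation factors as `k ∘ Z`, and the hypothesis makes `k x - x` orthogonal to
all smooth compactly supported functions under the law of `Z`, hence zero almost everywhere for that
law. -/
theorem condExp_comap_ae_eq_self_of_forall_integral {Ω : Type*} [mΩ : MeasurableSpace Ω]
    {P : Measure Ω} [IsProbabilityMeasure P] {X Z : Ω → ℝ} (hZ : Measurable Z)
    (hX : Integrable X P) (hZi : Integrable Z P)
    (h : ∀ g : ℝ → ℝ, Continuous g → HasCompactSupport g → ∫ ω, g (Z ω) * (Z ω - X ω) ∂P = 0) :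
    P[X | MeasurableSpace.comap Z inferInstance] =ᵐ[P] Z := by
  have hm := hZ.comap_le
  obtain ⟨k, hk, hkZ⟩ := (stronglyMeasurable_condExp (μ := P) (f := X)
    (m := MeasurableSpace.comap Z inferInstance)).measurable.exists_eq_measurable_comp
  have hki : Integrable (k ∘ Z) P := hkZ ▸ integrable_condExp
  have hfi : Integrable (fun x => k x - x) (P.map Z) :=
    (integrable_map_measure (hk.sub measurable_id).aestronglyMeasurable hZ.aemeasurable).mpr
      (hki.sub hZi)
  have hae := ae_eq_zero_of_integral_contDiff_smul_eq_zero hfi.locallyIntegrable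
    (fun g hg hgs => by
      obtain ⟨C, hC⟩ := hgs.exists_bound_of_continuous hg.continuous
      have hgm : StronglyMeasurable[MeasurableSpace.comap Z inferInstance] (fun ω => g (Z ω)) :=
        (hg.continuous.measurable.comp (comap_measurable Z)).stronglyMeasurable
      have hbd : ∀ {f : Ω → ℝ}, Integrable f P → Integrable (fun ω => g (Z ω) * f ω) P :=
        fun hf => hf.bdd_mul (hgm.mono hm).aestronglyMeasurable
          (Filter.Eventually.of_forall fun ω => hC _)
      have hgk : Measurable fun x => g x • (k x - x) :=
        hg.continuous.measurable.smul (hk.sub measurable_id)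
      rw [integral_map hZ.aemeasurable hgk.aestronglyMeasurable]
      have h1 : ∫ ω, g (Z ω) * k (Z ω) ∂P = ∫ ω, g (Z ω) * X ω ∂P := by
        rw [← integral_condExp hm (f := fun ω => g (Z ω) * X ω)]
        refine integral_congr_ae ?_
        filter_upwards [condExp_mul_of_stronglyMeasurable_left hgm (hbd hX) hX] with ω hω
        have h2 := congrFun hkZ ω
        simp only [Function.comp_apply] at h2
        rw [← h2]
        exact hω.symm
      have h3 := h g hg.continuous hgs
      simp only [smul_eq_mul, mul_sub] at h3 ⊢
      rw [integral_sub (hbd hZi) (hbd hX)] at h3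
      refine (integral_sub (hbd hki) (hbd hZi)).trans ?_
      simp only [Function.comp_apply]
      linarith)
  rw [hkZ]
  filter_upwards [ae_of_ae_map hZ.aemeasurable hae] with ω hω
  simpa [sub_eq_zero] using hω

theorem LipschitzWith.comp_absolutelyContinuousOnInterval {X X' : Type*} [PseudoMetricSpace X]
    [PseudoMetricSpace X'] {K : NNReal} {φ : X → X'} (hφ : LipschitzWith K φ) {f : ℝ → X} {a b : ℝ}
    (hf : AbsolutelyContinuousOnInterval f a b) : AbsolutelyContinuousOnInterval (φ ∘ f) a b := by
  rw [absolutelyContinuousOnInterval_iff] at hf ⊢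
  intro ε hε
  -- `K + 1` rather than `K` covers the case `K = 0`.
  obtain ⟨δ, hδ, h⟩ := hf (ε / (K + 1)) (by positivity)
  refine ⟨δ, hδ, fun E hE hEδ => ?_⟩
  have h1 := h E hE hEδ
  rw [lt_div_iff₀ (by positivity)] at h1
  refine lt_of_le_of_lt ?_ h1
  rw [Finset.sum_mul]
  refine Finset.sum_le_sum fun i _ => (hφ.dist_le_mul _ _).trans ?_
  rw [mul_comm]
  exact mul_le_mul_of_nonneg_left (by linarith) dist_nonneg

/-- The substitution `u = t + s` moves the shift from the path, which has no regularity, to the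
smooth exponential factor and a limit of integration. -/
theorem integral_expMeasure_comp_add {r : ℝ} (hr : 0 < r) {y : ℝ → ℝ}
    (hy : Integrable y (expMeasure r)) {s : ℝ} (hs : 0 ≤ s) :
    ∫ t, y (t + s) ∂(expMeasure r) = Real.exp (r * s) *
      ((∫ u in Set.Ioi 0, r * Real.exp (-(r * u)) * y u)
        - ∫ u in (0 : ℝ)..s, r * Real.exp (-(r * u)) * y u) := by
  have hq := (integrable_expMeasure_iff hr y).mp hy
  simp only [smul_eq_mul] at hq
  rw [← intervalIntegral.integral_Ioi_sub_Ioi hq hs, sub_sub_cancel, integral_expMeasure hr]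
  have h1 := (measurePreserving_add_right volume s).setIntegral_preimage_emb
    (measurableEmbedding_addRight s) (fun u => r * Real.exp (-(r * u)) * y u) (Set.Ioi s)
  have h2 : (fun x => x + s) ⁻¹' Set.Ioi s = Set.Ioi 0 := by ext; simp
  rw [h2] at h1
  rw [← h1, ← integral_const_mul]
  refine integral_congr_ae (Filter.Eventually.of_forall fun x => ?_)
  simp only [smul_eq_mul]
  have h3 : Real.exp (-(r * x)) = Real.exp (r * s) * Real.exp (-(r * (x + s))) := by
    rw [← Real.exp_add]
    congr 1
    ring
  rw [h3]
  ring

/-- The exponential average `Z` of a path `y` is absolutely continuous with `Z' = r (Z - y)`; this is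
the resulting chain rule on `[0, 1]`. -/
theorem sub_eq_integral_expMeasure_comp_add {r : ℝ} (hr : 0 < r) {y : ℝ → ℝ}
    (hy : Integrable y (expMeasure r)) {φ g : ℝ → ℝ} {K : NNReal} (hφ : LipschitzWith K φ)
    (hφg : ∀ x, HasDerivAt φ (g x) x) :
    φ (∫ t, y (t + 1) ∂(expMeasure r)) - φ (∫ t, y t ∂(expMeasure r)) =
      ∫ s in (0 : ℝ)..1, g (∫ t, y (t + s) ∂(expMeasure r)) *
        (r * ((∫ t, y (t + s) ∂(expMeasure r)) - y s)) := by
  have hq := (integrable_expMeasure_iff hr y).mp hy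
  simp only [smul_eq_mul] at hq
  set q : ℝ → ℝ := fun u => r * Real.exp (-(r * u)) * y u with hqdef
  have hqi : IntervalIntegrable q volume 0 1 :=
    (intervalIntegrable_iff_integrableOn_Ioc_of_le zero_le_one).mpr
      (hq.mono_set Set.Ioc_subset_Ioi_self)
  set Z : ℝ → ℝ := fun s => Real.exp (r * s) * ((∫ u in Set.Ioi 0, q u) - ∫ u in (0 : ℝ)..s, q u)
    with hZdef
  have hz : ∀ s, 0 ≤ s → ∫ t, y (t + s) ∂(expMeasure r) = Z s := fun s hs =>
    integral_expMeasure_comp_add hr hy hs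
  have hz0 : ∫ t, y t ∂(expMeasure r) = Z 0 := by simpa using hz 0 le_rfl
  -- The path is only integrable, so `Z` is differentiated only almost everywhere; absolute
  -- continuity is what still permits the fundamental theorem of calculus.
  have hac : AbsolutelyContinuousOnInterval Z 0 1 := by
    have h1 : ContDiffOn ℝ 1 (fun s => Real.exp (r * s)) (Set.uIcc 0 1) := by fun_prop
    have h2 : ContDiffOn ℝ 1 (fun _ : ℝ => ∫ u in Set.Ioi 0, q u) (Set.uIcc 0 1) := by fun_prop
    exact h1.absolutelyContinuousOnInterval.mul (h2.absolutelyContinuousOnInterval.sub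
      (hqi.absolutelyContinuousOnInterval_intervalIntegral (by simp)))
  have hac' := hφ.comp_absolutelyContinuousOnInterval hac
  rw [hz 1 zero_le_one, hz0]
  refine (hac'.integral_deriv_eq_sub).symm.trans (intervalIntegral.integral_congr_ae ?_)
  filter_upwards [hqi.ae_hasDerivAt_integral] with s hs hs'
  have hs0 : 0 ≤ s := by
    rw [Set.uIoc_of_le zero_le_one] at hs'
    exact hs'.1.le
  have hd := hs (Set.uIoc_subset_uIcc hs') 0 (by simp)
  have hexp : HasDerivAt (fun s => Real.exp (r * s)) (Real.exp (r * s) * r) s := by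
    simpa using ((hasDerivAt_id s).const_mul r).exp
  have hZd := hexp.mul (hd.const_sub (∫ u in Set.Ioi 0, q u))
  have h3 := ((hφg (Z s)).comp s hZd).deriv
  rw [hz s hs0]
  refine h3.trans ?_
  congr 1
  have h4 : Real.exp (r * s) * q s = r * y s := by
    rw [hqdef]
    simp only
    have : Real.exp (r * s) * Real.exp (-(r * s)) = 1 := by rw [← Real.exp_add]; simp
    linear_combination (r * y s) * this
  simp only [hZdef]
  linear_combination -h4

/-- An antiderivative of `g` evaluated at the shifted average has constant expectation, so the
expected integral of its derivative over `[0, 1]` vanishes; by joint stationarity the integrand has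
the same expectation at every time. -/
theorem expMeasure_integral_comp_mul_sub_eq_zero {Ω : Type*} [MeasurableSpace Ω] {P : Measure Ω}
    [IsProbabilityMeasure P] {Y : ℝ → Ω → ℝ} (hst : IsStationaryProcess Y P)
    (hY : Measurable (Function.uncurry Y)) (hint : Integrable (Y 0) P) {r : ℝ} (hr : 0 < r)
    {g : ℝ → ℝ} (hg : Continuous g) (hgs : HasCompactSupport g) :
    ∫ ω, g (∫ t, Y t ω ∂(expMeasure r)) * ((∫ t, Y t ω ∂(expMeasure r)) - Y 0 ω) ∂P = 0 := by
  have := isProbabilityMeasure_expMeasure hr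
  set F := expMeasure r with hF
  have hYt : ∀ t, Measurable (Y t) := fun t => hY.comp measurable_prodMk_left
  have hZj : Measurable fun p : ℝ × Ω => ∫ t, Y (t + p.1) p.2 ∂F := by
    have h1 : Measurable fun p : (ℝ × Ω) × ℝ => (p.2 + p.1.1, p.1.2) := by fun_prop
    exact (hY.comp h1).stronglyMeasurable.integral_prod_right'.measurable
  obtain ⟨C, hC⟩ := hgs.exists_bound_of_continuous hg
  have hC0 : 0 ≤ C := (norm_nonneg _).trans (hC 0)
  let φ : ℝ → ℝ := fun x => ∫ t in (0 : ℝ)..x, g t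
  have hφg : ∀ x, HasDerivAt φ (g x) x := fun x =>
    intervalIntegral.integral_hasDerivAt_right (hg.intervalIntegrable _ _)
      (hg.stronglyMeasurableAtFilter _ _) hg.continuousAt
  -- The Lipschitz bound gives `φ` linear growth, so `φ ∘ Z` is integrable although `Z` is only in
  -- `L¹`.
  have hφ : LipschitzWith C.toNNReal φ := by
    refine lipschitzWith_of_nnnorm_deriv_le (fun x => (hφg x).differentiableAt) fun x => ?_
    rw [(hφg x).deriv, ← NNReal.coe_le_coe, coe_nnnorm, Real.coe_toNNReal C hC0]
    exact hC x
  have hid : ∀ s, IdentDistrib (fun ω => (∫ t, Y (t + s) ω ∂F, Y s ω))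
      (fun ω => (∫ t, Y t ω ∂F, Y 0 ω)) P P := fun s =>
    ⟨((hZj.comp measurable_prodMk_left).prodMk (hYt s)).aemeasurable,
      by simpa using ((hZj.comp (measurable_prodMk_left (x := 0))).prodMk (hYt 0)).aemeasurable,
      hst.map_integral_prodMk_eq hY hint F s⟩
  have hZint : ∀ s, Integrable (fun ω => ∫ t, Y (t + s) ω ∂F) P := fun s =>
    (hst.integrable_prod hY hint F s).integral_prod_right
  have hZ0 : Integrable (fun ω => ∫ t, Y t ω ∂F) P := by simpa using hZint 0
  have hφint : ∀ {Z : Ω → ℝ}, Integrable Z P → Integrable (fun ω => φ (Z ω)) P := by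
    intro Z hZ
    refine (hZ.norm.const_mul C).mono'
      (hφ.continuous.comp_aestronglyMeasurable hZ.aestronglyMeasurable)
      (Filter.Eventually.of_forall fun ω => ?_)
    have h1 := hφ.dist_le_mul (Z ω) 0
    simpa [φ, dist_zero_right, Real.coe_toNNReal C hC0, abs_of_nonneg hC0] using h1
  let H : ℝ × ℝ → ℝ := fun p => g p.1 * (r * (p.1 - p.2))
  have hH : Measurable H := by fun_prop
  have hidH : ∀ s, IdentDistrib (fun ω => H (∫ t, Y (t + s) ω ∂F, Y s ω))
      (fun ω => H (∫ t, Y t ω ∂F, Y 0 ω)) P P := fun s => (hid s).comp hH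
  have hH0 : Integrable (fun ω => H (∫ t, Y t ω ∂F, Y 0 ω)) P :=
    ((hZ0.sub hint).const_mul r).bdd_mul (hg.comp_aestronglyMeasurable hZ0.aestronglyMeasurable)
      (Filter.Eventually.of_forall fun ω => hC _)
  have hHprod : Integrable (fun p : ℝ × Ω => H (∫ t, Y (t + p.1) p.2 ∂F, Y p.1 p.2))
      ((volume.restrict (Set.Ioc 0 1)).prod P) := by
    have hm : Measurable fun p : ℝ × Ω => H (∫ t, Y (t + p.1) p.2 ∂F, Y p.1 p.2) :=
      hH.comp (hZj.prodMk hY)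
    rw [integrable_prod_iff hm.aestronglyMeasurable]
    refine ⟨Filter.Eventually.of_forall fun s => (hidH s).integrable_iff.mpr hH0, ?_⟩
    have h1 : ∀ s, ∫ ω, ‖H (∫ t, Y (t + s) ω ∂F, Y s ω)‖ ∂P
        = ∫ ω, ‖H (∫ t, Y t ω ∂F, Y 0 ω)‖ ∂P := fun s =>
      ((hidH s).comp measurable_norm).integral_eq
    simp_rw [h1]
    exact integrable_const _
  have hpath : ∀ᵐ ω ∂P, φ (∫ t, Y (t + 1) ω ∂F) - φ (∫ t, Y t ω ∂F)
      = ∫ s in Set.Ioc (0 : ℝ) 1, H (∫ t, Y (t + s) ω ∂F, Y s ω) := by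
    filter_upwards [(hst.integrable_prod hY hint F 0).prod_left_ae] with ω hω
    simp only [add_zero] at hω
    rw [← intervalIntegral.integral_of_le zero_le_one]
    exact sub_eq_integral_expMeasure_comp_add hr hω hφ hφg
  have h1 : ∫ ω, (φ (∫ t, Y (t + 1) ω ∂F) - φ (∫ t, Y t ω ∂F)) ∂P = 0 := by
    have h2 : ∫ ω, φ (∫ t, Y (t + 1) ω ∂F) ∂P = ∫ ω, φ (∫ t, Y t ω ∂F) ∂P :=
      ((hid 1).comp (hφ.continuous.measurable.comp measurable_fst)).integral_eq
    rw [integral_sub (hφint (hZint 1)) (hφint hZ0), h2, sub_self]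
  rw [integral_congr_ae hpath, ← integral_integral_swap hHprod] at h1
  have h3 : ∀ s, ∫ ω, H (∫ t, Y (t + s) ω ∂F, Y s ω) ∂P
      = ∫ ω, H (∫ t, Y t ω ∂F, Y 0 ω) ∂P := fun s => (hidH s).integral_eq
  simp_rw [h3] at h1
  have h4 : ∀ ω, H (∫ t, Y t ω ∂F, Y 0 ω)
      = r * (g (∫ t, Y t ω ∂F) * ((∫ t, Y t ω ∂F) - Y 0 ω)) := fun ω => by
    simp only [H]
    ring
  simp_rw [h4] at h1
  rw [integral_const_mul] at h1
  simpa [hr.ne'] using h1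

theorem conditioningIdentity_expMeasure {Ω : Type*} [MeasurableSpace Ω] {P : Measure Ω}
    [IsProbabilityMeasure P] {Y : ℝ → Ω → ℝ} (hst : IsStationaryProcess Y P)
    (hY : Measurable (Function.uncurry Y)) (hint : Integrable (Y 0) P) {r : ℝ} (hr : 0 < r) :
    ConditioningIdentity (expMeasure r) Y P := by
  have := isProbabilityMeasure_expMeasure hr
  have hwa : weightedAverage (expMeasure r) Y = fun ω => ∫ t, Y t ω ∂(expMeasure r) := by
    have hr : (expMeasure r).restrict (Set.Ici 0) = expMeasure r := by
      refine Measure.restrict_eq_self_of_ae_mem ?_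
      rw [ae_iff]
      refine measure_mono_null (fun x hx => ?_) (expMeasure_Iic_zero r)
      simp only [Set.mem_Ici, not_le, Set.mem_ofPred_eq] at hx
      exact hx.le
    funext ω
    rw [weightedAverage, hr]
  have hZm : Measurable (weightedAverage (expMeasure r) Y) :=
    Measurable.of_comap_le (comap_weightedAverage_le _ Y hY)
  have hZi : Integrable (weightedAverage (expMeasure r) Y) P := by
    have := (hst.integrable_prod hY hint (expMeasure r) 0).integral_prod_right
    rw [hwa]
    simpa using this
  refine condExp_comap_ae_eq_self_of_forall_integral hZm hint hZi fun g hg hgs => ?_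
  rw [hwa]
  exact expMeasure_integral_comp_mul_sub_eq_zero hst hY hint hr hg hgs

theorem conditioningIdentity_dirac_zero {Ω : Type*} [MeasurableSpace Ω] {P : Measure Ω}
    [IsProbabilityMeasure P] {Y : ℝ → Ω → ℝ} (hY : Measurable (Function.uncurry Y))
    (hint : Integrable (Y 0) P) : ConditioningIdentity (Measure.dirac 0) Y P := by
  have hwa : weightedAverage (Measure.dirac 0) Y = Y 0 := by
    funext ω
    rw [weightedAverage, restrict_dirac' measurableSet_Ici]
    simp
  have hm := comap_weightedAverage_le (Measure.dirac 0) Y hY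
  rw [ConditioningIdentity]
  rw [hwa] at hm ⊢
  rw [condExp_of_stronglyMeasurable hm (comap_measurable (Y 0)).stronglyMeasurable hint]

theorem proposition3p3 (F : Measure ℝ) [IsProbabilityMeasure F]
    (hF : F (Set.Iio 0) = 0)
    (hF' : HasLebesgueDensity F ∨ IsLatticeDistribution F) :
    (∀ (Ω : Type*) [MeasurableSpace Ω] (P : Measure Ω) [IsProbabilityMeasure P]
        (Y : ℝ → Ω → ℝ),
        Measurable (Function.uncurry Y) → IsStationaryProcess Y P → Integrable (Y 0) P →
        ConditioningIdentity F Y P) ↔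
      ((∃ r : ℝ, 0 < r ∧ F = expMeasure r) ∨ F = Measure.dirac 0) := by
  constructor
  · intro h
    exact eq_expMeasure_or_dirac_of_relation F hF
      (charFun_relation_of_conditioningIdentity F hF h)
  · rintro (⟨r, hr, rfl⟩ | rfl) Ω _ P _ Y hY hst hint
    · exact conditioningIdentity_expMeasure hst hY hint hr
    · exact conditioningIdentity_dirac_zero hY hint
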